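/- Let $p\ge 2$, let $\|\cdot\|$ be the Euclidean norm on $\mathbb{R}^p$, and let $s(x)=x/\|x\|$ for $x\neq 0$, $s(0)=0$. For a probability distribution $F$ on $\mathbb{R}^p$ and $X\sim F$ let $\mu=\mu(F)$ be the spatial median, i.e. the minimizer of $m\mapsto E(\|X-m\|-\|X\|)$ (the barycenter of the set of minimizers if there are several), and let $S(F)=E\{s(X-\mu)s(X-\mu)^T\}$ be the spatial sign covariance matrix. For $x_1,\dots,x_n,t\in\mathbb{R}^p$ let $\hat S_n(x_1,\dots,x_n;t)=\frac1n\sum_{i=1}^n s(x_i-t)s(x_i-t)^T$. Let $X_1,X_2,\dots$ be i.i.d. with distribution $F$ such that $E\|X-\mu\|^{-1}<\infty$, and let $(T_n)$ be a sequence of $\mathbb{R}^p$-valued random variables, on the same probability space, converging almost surely to $\mu$. Write $\hat S_n=\hat S_n(X_1,\dots,X_n;T_n)$. Then, as $n\to\infty$: (1) $\hat S_n\to S(F)$ almost surely. (2) If furthermore $\sqrt n\,\|T_n-\mu\|$ converges in distribution, $E\|X-\mu\|^{-3/2}<\infty$, and $X-\mu$ and $-(X-\mu)$ have the same distribution, then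 there is a symmetric non-negative definite $p^2\times p^2$ matrix $W_S$ with $$\sqrt n\,\operatorname{vec}\{\hat S_n-S(F)\}\xrightarrow{d}N_{p^2}(0,W_S),$$ where $\operatorname{vec}$ stacks the columns of a matrix from left to right underneath each other. (3) If, in addition to all assumptions of (2), $p=2$ and $F$ is elliptical, i.e. has a Lebesgue density $f(x)=\det(V)^{-1/2}g\big((x-m)^TV^{-1}(x-m)\big)$ with some $m\in\mathbb{R}^2$, some symmetric positive definite $V$ and some measurable $g\ge 0$, and if $V=U\operatorname{diag}(\lambda_1,\lambda_2)U^T$ with $U$ orthogonal and $0<\lambda_2\le\lambda_1$, then $$W_S=\frac{-\lambda_1\lambda_2+\frac12\sqrt{\lambda_1\lambda_2}\,(\lambda_1+\lambda_2)}{(\lambda_1-\lambda_2)^2}\,(U\otimes U)W_0(U\otimes U)^T,\qquad W_0=\begin{pmatrix}1&0&0&-1\\0&1&1&0\\0&1&1&0\\-1&0&0&1\end{pmatrix},$$ where for $\lambda_1=\lambda_2$ the fraction is read as its limit $1/8$. -/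

import Mathlib

open MeasureTheory ProbabilityTheory Filter Topology
open scoped Matrix Kronecker ENNReal

noncomputable section

namespace SSCM

/-- The spatial sign `s(x) = x / ‖x‖`; since `0⁻¹ = 0` this gives `s(0) = 0`. -/
def spatialSign {p : ℕ} (x : EuclideanSpace ℝ (Fin p)) : EuclideanSpace ℝ (Fin p) :=
  ‖x‖⁻¹ • x

/-- The rank-one matrix `s(x) s(x)ᵀ`. -/
def signOuter {p : ℕ} (x : EuclideanSpace ℝ (Fin p)) : Matrix (Fin p) (Fin p) ℝ :=
  Matrix.vecMulVec (spatialSign x).ofLp (spatialSign x).ofLp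

/-- The set of minimizers of `m ↦ E(‖X - m‖ - ‖X‖)`, where `X` has distribution `F`. -/
def medianSet {p : ℕ} (F : Measure (EuclideanSpace ℝ (Fin p))) :
    Set (EuclideanSpace ℝ (Fin p)) :=
  {m | ∀ m', ∫ x, (‖x - m‖ - ‖x‖) ∂F ≤ ∫ x, (‖x - m'‖ - ‖x‖) ∂F}

/-- The barycenter of a convex set `C`: the mean of the uniform distribution on `C`, i.e. of the
normalized Hausdorff measure whose dimension is the affine dimension of `C`. For a one-point set
this is the point, for a segment its midpoint. -/
def barycenter {p : ℕ} (C : Set (EuclideanSpace ℝ (Fin p))) : EuclideanSpace ℝ (Fin p) :=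
  ⨍ x in C, x ∂(μH[(Module.finrank ℝ (vectorSpan ℝ C) : ℝ)])

/-- The spatial median `μ(F)`: the minimizer of `m ↦ E(‖X - m‖ - ‖X‖)`, and the barycenter of
the set of minimizers if there are several. -/
def spatialMedian {p : ℕ} (F : Measure (EuclideanSpace ℝ (Fin p))) : EuclideanSpace ℝ (Fin p) :=
  barycenter (medianSet F)

/-- The spatial sign covariance matrix `S(F) = E(s(X - μ(F)) s(X - μ(F))ᵀ)`, entry by entry. -/
def sscm {p : ℕ} (F : Measure (EuclideanSpace ℝ (Fin p))) : Matrix (Fin p) (Fin p) ℝ :=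
  Matrix.of fun i j => ∫ x, signOuter (x - spatialMedian F) i j ∂F

/-- The empirical spatial sign covariance matrix of the sample `x` of size `n` with respect to
the location `t`. -/
def empiricalSSCM {p n : ℕ} (x : Fin n → EuclideanSpace ℝ (Fin p))
    (t : EuclideanSpace ℝ (Fin p)) : Matrix (Fin p) (Fin p) ℝ :=
  (n : ℝ)⁻¹ • ∑ i, signOuter (x i - t)

/-- The column-stacking operator `vec`, with values in a Euclidean space; the coordinate `(j, i)`
of `vecE A` is `A i j`. -/
def vecE {p : ℕ} (A : Matrix (Fin p) (Fin p) ℝ) : EuclideanSpace ℝ (Fin p × Fin p) :=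
  WithLp.toLp 2 (Matrix.vec A)

/-- `F` is a continuous elliptical distribution with symmetry center `m` and shape matrix `V`:
it has the Lebesgue density `det(V)^(-1/2) g((x - m)ᵀ V⁻¹ (x - m))`. -/
def IsElliptical {p : ℕ} (F : Measure (EuclideanSpace ℝ (Fin p)))
    (m : EuclideanSpace ℝ (Fin p)) (V : Matrix (Fin p) (Fin p) ℝ) : Prop :=
  V.PosDef ∧ ∃ g : ℝ → ℝ, Measurable g ∧ (∀ t, 0 ≤ g t) ∧
    F = volume.withDensity fun x => ENNReal.ofReal
      ((√V.det)⁻¹ * g ((x - m).ofLp ⬝ᵥ (V⁻¹ *ᵥ (x - m).ofLp)))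

/-- The matrix `W₀`. -/
def W₀ : Matrix (Fin 4) (Fin 4) ℝ :=
  !![1, 0, 0, -1;
     0, 1, 1, 0;
     0, 1, 1, 0;
     -1, 0, 0, 1]

/-- The scalar factor of the asymptotic covariance matrix. On the diagonal `a = b`, where the
quotient has the form `0 / 0`, it stands for its continuous extension, which is `1 / 8`. -/
def covFactor (a b : ℝ) : ℝ :=
  if a = b then 1 / 8 else (-(a * b) + 1 / 2 * √(a * b) * (a + b)) / (a - b) ^ 2

/-- Position `2 j + i` in `vec A` of the entry `A i j` of a 2 × 2 matrix `A`. -/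
def vecIndex {p : ℕ} (hp : p = 2) (q : Fin p × Fin p) : Fin 4 :=
  finProdFinEquiv (Fin.cast hp q.1, Fin.cast hp q.2)

end SSCM

end

/-!
The spatial sign outer product `s(y) s(y)ᵀ` is `B y y / ‖y‖²` for the bilinear map
`B u v = vec (u vᵀ)`. Its increment in the direction `u` is at most of order `‖u‖ / ‖y‖`, and it
equals a derivative of order `1 / ‖y‖` applied to `u`, up to a remainder of order
`(‖u‖ / ‖y‖) min (‖u‖ / ‖y‖, 1)`. The derivative is odd in `y`, so under a symmetric distribution
its sample average tends to zero by the strong law. Replacing `T n` by the centre therefore changes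
the sample covariance by `o(‖T n - c‖)`, which is negligible at the scale `√n`, and the central
limit theorem for i.i.d. vectors gives the limit.

In the plane the entries of `s(y) s(y)ᵀ` are affine in `ζ = z / conj z`, where `z` is `y` written as
a complex number in the eigenbasis of the shape matrix. For an elliptical distribution `ζ` is
distributed as a Blaschke factor in `w²` with `w` uniform on the unit circle, so by the mean value
property its `k`-th moment is the `k`-th power of `κ = (√λ₁ - √λ₂) / (√λ₁ + √λ₂)`. The moments for
`k = 1, 2` are all that the covariance matrix depends on.
-/

noncomputable section

namespace SSCM

section SignQuad

variable {H G : Type*} [NormedAddCommGroup H] [InnerProductSpace ℝ H]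
  [NormedAddCommGroup G] [NormedSpace ℝ G] (B : H →L[ℝ] H →L[ℝ] G)

/-- The value `B (s(y), s(y))` of a bilinear map at the spatial sign `s(y) = y / ‖y‖`, with the
value `0` at `y = 0`. For the outer product this is the matrix `s(y) s(y)ᵀ`. -/
def signQuad (y : H) : G :=
  (‖y‖ ^ 2)⁻¹ • B y y

/-- The derivative of `u ↦ signQuad B (y + u)` at `u = 0`. -/
def signQuadDeriv (y : H) : H →L[ℝ] G :=
  (‖y‖ ^ 2)⁻¹ • (B y + B.flip y - (2 : ℝ) • (innerSL ℝ y).smulRight (signQuad B y))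

lemma signQuad_neg (y : H) : signQuad B (-y) = signQuad B y := by
  simp [signQuad]

lemma signQuadDeriv_neg (y : H) : signQuadDeriv B (-y) = -signQuadDeriv B y := by
  ext u
  simp only [signQuadDeriv, signQuad_neg, norm_neg, map_neg, smul_apply,
    sub_apply, add_apply, neg_apply,
    ContinuousLinearMap.smulRight_apply, neg_smul]
  module

lemma norm_signQuad_le (y : H) : ‖signQuad B y‖ ≤ ‖B‖ := by
  rcases eq_or_ne y 0 with rfl | hy
  · rw [signQuad, map_zero, smul_zero, norm_zero]
    exact norm_nonneg B
  have := norm_pos_iff.2 hy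
  rw [signQuad, norm_smul, norm_inv, norm_pow, norm_norm, inv_mul_le_iff₀ (by positivity)]
  exact (B.le_opNorm₂ y y).trans_eq (by ring)

lemma sq_norm_smul_signQuad (y : H) : ‖y‖ ^ 2 • signQuad B y = B y y := by
  rcases eq_or_ne y 0 with rfl | hy
  · simp
  · exact smul_inv_smul₀ (by simpa using hy) _

lemma sq_norm_smul_signQuadDeriv_apply (y u : H) :
    ‖y‖ ^ 2 • signQuadDeriv B y u = B y u + B u y - (2 * inner ℝ y u) • signQuad B y := by
  rcases eq_or_ne y 0 with rfl | hy
  · simp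
  · simp [signQuadDeriv, smul_smul, hy]

lemma norm_signQuadDeriv_le (y : H) : ‖signQuadDeriv B y‖ ≤ 4 * ‖B‖ * ‖y‖⁻¹ := by
  rcases eq_or_ne y 0 with rfl | hy
  · simp [signQuadDeriv]
  have := norm_pos_iff.2 hy
  have hleft : ‖B y‖ ≤ ‖B‖ * ‖y‖ := B.le_opNorm y
  have hright : ‖B.flip y‖ ≤ ‖B‖ * ‖y‖ := by simpa using B.flip.le_opNorm y
  have hinner : ‖(2 : ℝ) • (innerSL ℝ y).smulRight (signQuad B y)‖ ≤ 2 * (‖y‖ * ‖B‖) := by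
    rw [norm_smul, ContinuousLinearMap.norm_smulRight_apply, innerSL_apply_norm, Real.norm_two]
    gcongr
    exact norm_signQuad_le B y
  rw [signQuadDeriv, norm_smul, norm_inv, norm_pow, norm_norm, inv_mul_le_iff₀ (by positivity)]
  calc _ ≤ ‖B y‖ + ‖B.flip y‖ + ‖(2 : ℝ) • (innerSL ℝ y).smulRight (signQuad B y)‖ :=
        norm_sub_le_of_le (norm_add_le _ _) le_rfl
    _ ≤ 4 * ‖B‖ * ‖y‖ := by linarith
    _ = ‖y‖ ^ 2 * (4 * ‖B‖ * ‖y‖⁻¹) := by field_simp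

lemma sq_norm_smul_signQuad_add_sub (y u : H) :
    ‖y‖ ^ 2 • (signQuad B (y + u) - signQuad B y) =
      B y u + B u y + B u u - (2 * inner ℝ y u + ‖u‖ ^ 2) • signQuad B (y + u) := by
  have h := sq_norm_smul_signQuad B (y + u)
  simp only [norm_add_sq_real, map_add, add_apply] at h
  rw [smul_sub, sq_norm_smul_signQuad]
  linear_combination (norm := module) h

lemma norm_signQuad_add_sub_le {y : H} (hy : y ≠ 0) (u : H) :
    ‖signQuad B (y + u) - signQuad B y‖ ≤ 6 * ‖B‖ * min (‖u‖ * ‖y‖⁻¹) 1 := by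
  have hy' : 0 < ‖y‖ := norm_pos_iff.2 hy
  have hbdd : ‖signQuad B (y + u) - signQuad B y‖ ≤ ‖B‖ + ‖B‖ :=
    norm_sub_le_of_le (norm_signQuad_le B _) (norm_signQuad_le B _)
  have hB := norm_nonneg B
  rcases le_total ‖y‖ ‖u‖ with h | h
  · rw [min_eq_right (by rwa [← div_eq_mul_inv, one_le_div hy'])]
    linarith
  rw [min_eq_left (by rwa [← div_eq_mul_inv, div_le_one hy'])]
  have hcoeff : ‖2 * inner ℝ y u + ‖u‖ ^ 2‖ ≤ 3 * (‖y‖ * ‖u‖) := by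
    refine (norm_add_le _ _).trans ?_
    rw [norm_mul, Real.norm_two, norm_pow, norm_norm]
    nlinarith [norm_inner_le_norm (𝕜 := ℝ) y u, norm_nonneg u]
  have hlast : ‖(2 * inner ℝ y u + ‖u‖ ^ 2) • signQuad B (y + u)‖ ≤ 3 * (‖y‖ * ‖u‖) * ‖B‖ := by
    rw [norm_smul]
    gcongr
    exact norm_signQuad_le B _
  have hsq : ‖B‖ * ‖u‖ * ‖u‖ ≤ ‖B‖ * ‖y‖ * ‖u‖ := by gcongr
  have key : ‖y‖ ^ 2 * ‖signQuad B (y + u) - signQuad B y‖ ≤ 6 * (‖B‖ * ‖y‖ * ‖u‖) := by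
    rw [← norm_smul_of_nonneg (sq_nonneg ‖y‖), sq_norm_smul_signQuad_add_sub]
    calc _ ≤ ‖B‖ * ‖y‖ * ‖u‖ + ‖B‖ * ‖u‖ * ‖y‖ + ‖B‖ * ‖u‖ * ‖u‖ + 3 * (‖y‖ * ‖u‖) * ‖B‖ :=
          norm_sub_le_of_le (norm_add_le_of_le (norm_add_le_of_le (B.le_opNorm₂ y u)
            (B.le_opNorm₂ u y)) (B.le_opNorm₂ u u)) hlast
      _ ≤ 6 * (‖B‖ * ‖y‖ * ‖u‖) := by linarith
  refine le_of_mul_le_mul_left (key.trans_eq ?_) (by positivity : 0 < ‖y‖ ^ 2)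
  field_simp

lemma sq_norm_smul_signQuad_add_sub_sub_deriv (y u : H) :
    ‖y‖ ^ 2 • (signQuad B (y + u) - signQuad B y - signQuadDeriv B y u) =
      B u u - (2 * inner ℝ y u) • (signQuad B (y + u) - signQuad B y)
        - ‖u‖ ^ 2 • signQuad B (y + u) := by
  rw [smul_sub, sq_norm_smul_signQuad_add_sub, sq_norm_smul_signQuadDeriv_apply]
  module

lemma norm_signQuad_add_sub_sub_deriv_le {y : H} (hy : y ≠ 0) (u : H) :
    ‖signQuad B (y + u) - signQuad B y - signQuadDeriv B y u‖ ≤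
      14 * ‖B‖ * (‖u‖ * ‖y‖⁻¹ * min (‖u‖ * ‖y‖⁻¹) 1) := by
  have hy' : 0 < ‖y‖ := norm_pos_iff.2 hy
  have hB := norm_nonneg B
  have hincr := norm_signQuad_add_sub_le B hy u
  rcases le_total ‖y‖ ‖u‖ with h | h
  · have hr : 1 ≤ ‖u‖ * ‖y‖⁻¹ := by rwa [← div_eq_mul_inv, one_le_div hy']
    have hderiv : ‖signQuadDeriv B y u‖ ≤ 4 * ‖B‖ * (‖u‖ * ‖y‖⁻¹) :=
      ((signQuadDeriv B y).le_of_opNorm_le (norm_signQuadDeriv_le B y) u).trans_eq (by ring)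
    rw [min_eq_right hr] at hincr ⊢
    refine (norm_sub_le_of_le hincr hderiv).trans ?_
    nlinarith
  have hr : ‖u‖ * ‖y‖⁻¹ ≤ 1 := by rwa [← div_eq_mul_inv, div_le_one hy']
  rw [min_eq_left hr] at hincr ⊢
  have hcross : ‖(2 * inner ℝ y u) • (signQuad B (y + u) - signQuad B y)‖ ≤
      2 * (‖y‖ * ‖u‖) * (6 * ‖B‖ * (‖u‖ * ‖y‖⁻¹)) := by
    rw [norm_smul, norm_mul, Real.norm_two]
    gcongr
    exact norm_inner_le_norm y u
  have hsq : ‖‖u‖ ^ 2 • signQuad B (y + u)‖ ≤ ‖u‖ ^ 2 * ‖B‖ := by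
    rw [norm_smul, norm_pow, norm_norm]
    gcongr
    exact norm_signQuad_le B _
  have key : ‖y‖ ^ 2 * ‖signQuad B (y + u) - signQuad B y - signQuadDeriv B y u‖ ≤
      14 * ‖B‖ * ‖u‖ ^ 2 := by
    rw [← norm_smul_of_nonneg (sq_nonneg ‖y‖), sq_norm_smul_signQuad_add_sub_sub_deriv]
    refine (norm_sub_le_of_le (norm_sub_le_of_le (B.le_opNorm₂ u u) hcross) hsq).trans_eq ?_
    field_simp
    ring
  refine le_of_mul_le_mul_left (key.trans_eq ?_) (by positivity : 0 < ‖y‖ ^ 2)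
  field_simp

lemma norm_average_le (n : ℕ) {f : ℕ → G} {g : ℕ → ℝ} (h : ∀ k, ‖f k‖ ≤ g k) :
    ‖(n : ℝ)⁻¹ • ∑ k ∈ Finset.range n, f k‖ ≤ (n : ℝ)⁻¹ * ∑ k ∈ Finset.range n, g k := by
  rw [norm_smul, norm_inv, RCLike.norm_natCast]
  gcongr
  exact norm_sum_le_of_le _ fun k _ => h k

lemma norm_average_signQuad_add_sub_le (n : ℕ) {y : ℕ → H} (hy : ∀ k, y k ≠ 0) (u : H) :
    ‖(n : ℝ)⁻¹ • ∑ k ∈ Finset.range n, (signQuad B (y k + u) - signQuad B (y k))‖ ≤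
      (‖(n : ℝ)⁻¹ • ∑ k ∈ Finset.range n, signQuadDeriv B (y k)‖ + 14 * ‖B‖ *
        ((n : ℝ)⁻¹ * ∑ k ∈ Finset.range n, ‖y k‖⁻¹ * min (‖u‖ * ‖y k‖⁻¹) 1)) * ‖u‖ := by
  have hsplit : (n : ℝ)⁻¹ • ∑ k ∈ Finset.range n, (signQuad B (y k + u) - signQuad B (y k)) =
      ((n : ℝ)⁻¹ • ∑ k ∈ Finset.range n, signQuadDeriv B (y k)) u + (n : ℝ)⁻¹ •
        ∑ k ∈ Finset.range n,
          (signQuad B (y k + u) - signQuad B (y k) - signQuadDeriv B (y k) u) := by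
    simp only [smul_apply, sum_apply, Finset.sum_sub_distrib, smul_sub]
    abel
  have hrem := norm_average_le n fun k => norm_signQuad_add_sub_sub_deriv_le B (hy k) u
  rw [hsplit, add_mul]
  refine norm_add_le_of_le (ContinuousLinearMap.le_opNorm _ u) (hrem.trans_eq ?_)
  simp only [Finset.mul_sum, Finset.sum_mul]
  exact Finset.sum_congr rfl fun k _ => by ring

variable [MeasurableSpace H] [BorelSpace H] [SecondCountableTopology H]

lemma stronglyMeasurable_signQuad : StronglyMeasurable (signQuad B) :=
  have hnorm : Measurable fun y : H => (‖y‖ ^ 2)⁻¹ := by fun_prop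
  hnorm.stronglyMeasurable.smul
    (B.continuous₂.comp (continuous_id.prodMk continuous_id)).stronglyMeasurable

lemma stronglyMeasurable_signQuadDeriv : StronglyMeasurable (signQuadDeriv B) := by
  have hnorm : Measurable fun y : H => (‖y‖ ^ 2)⁻¹ := by fun_prop
  have hright : StronglyMeasurable fun y : H => (innerSL ℝ y).smulRight (signQuad B y) :=
    (ContinuousLinearMap.smulRightL ℝ H G).continuous₂.comp_stronglyMeasurable
      (((innerSL ℝ).continuous.comp_stronglyMeasurable stronglyMeasurable_id).prodMk
        (stronglyMeasurable_signQuad B))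
  exact hnorm.stronglyMeasurable.smul
    ((B.continuous.add B.flip.continuous).stronglyMeasurable.sub
      (hright.const_smul (2 : ℝ)))

lemma integrable_signQuad_sub (F : Measure H) [IsFiniteMeasure F] (c : H) :
    Integrable (fun x => signQuad B (x - c)) F :=
  .of_bound ((stronglyMeasurable_signQuad B).comp_measurable
    (measurable_sub_const c)).aestronglyMeasurable ‖B‖ (ae_of_all _ fun _ => norm_signQuad_le B _)

lemma integrable_signQuadDeriv_sub {F : Measure H} {c : H}
    (hint : Integrable (fun x => ‖x - c‖⁻¹) F) :
    Integrable (fun x => signQuadDeriv B (x - c)) F :=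
  (hint.const_mul (4 * ‖B‖)).mono' ((stronglyMeasurable_signQuadDeriv B).comp_measurable
    (measurable_sub_const c)).aestronglyMeasurable (ae_of_all _ fun _ => norm_signQuadDeriv_le B _)

lemma integral_signQuadDeriv_sub_eq_zero {F : Measure H} {c : H}
    (hsymm : F.map (fun x => x - c) = F.map (fun x => -(x - c))) :
    ∫ x, signQuadDeriv B (x - c) ∂F = 0 := by
  have hD : StronglyMeasurable (signQuadDeriv B) := stronglyMeasurable_signQuadDeriv B
  have hodd : ∫ x, signQuadDeriv B (x - c) ∂F = -∫ x, signQuadDeriv B (x - c) ∂F := calc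
    _ = ∫ y, signQuadDeriv B y ∂(F.map fun x => x - c) :=
      (integral_map (by fun_prop) hD.aestronglyMeasurable).symm
    _ = ∫ x, signQuadDeriv B (-(x - c)) ∂F := by
      rw [hsymm, integral_map (by fun_prop) hD.aestronglyMeasurable]
    _ = -∫ x, signQuadDeriv B (x - c) ∂F := by simp_rw [signQuadDeriv_neg, integral_neg]
  have := IsAddTorsionFree.of_isTorsionFree ℝ (H →L[ℝ] G)
  exact self_eq_neg.1 hodd

end SignQuad

section LawOfLargeNumbers

variable {Ω E G : Type*} [MeasurableSpace Ω] {P : Measure Ω} [MeasurableSpace E] {F : Measure E}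
  {X : ℕ → Ω → E}

lemma tendsto_average_ae [NormedAddCommGroup G] [NormedSpace ℝ G] [CompleteSpace G]
    [MeasurableSpace G] [BorelSpace G] (hX : ∀ i, HasLaw (X i) F P) (hindep : iIndepFun X P)
    {f : E → G} (hf : Measurable f) (hint : Integrable f F) :
    ∀ᵐ ω ∂P, Tendsto (fun n : ℕ => (n : ℝ)⁻¹ • ∑ k ∈ Finset.range n, f (X k ω)) atTop
      (𝓝 (∫ x, f x ∂F)) := by
  have hint0 : Integrable (fun ω => f (X 0 ω)) P :=
    ((hX 0).map_eq.symm ▸ hint).comp_aemeasurable (hX 0).aemeasurable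
  rw [← (hX 0).integral_comp hint.aestronglyMeasurable]
  exact strong_law_ae (fun i ω => f (X i ω)) hint0
    (fun i j hij => (hindep.indepFun hij).comp hf hf) fun i => ((hX i).identDistrib (hX 0)).comp hf

lemma tendsto_integral_mul_min_div_natCast {w v : E → ℝ} (hw : Integrable w F)
    (hv : Measurable v) (hv0 : ∀ x, 0 ≤ v x) :
    Tendsto (fun m : ℕ => ∫ x, w x * min (1 / ((m : ℝ) + 1) * v x) 1 ∂F) atTop (𝓝 0) := by
  have hlim : ∀ x, Tendsto (fun m : ℕ => w x * min (1 / ((m : ℝ) + 1) * v x) 1) atTop (𝓝 0) := by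
    intro x
    simpa using ((tendsto_one_div_add_atTop_nhds_zero_nat.mul_const (v x)).min
      (tendsto_const_nhds (x := (1 : ℝ)))).const_mul (w x)
  rw [← integral_zero E ℝ (μ := F)]
  refine tendsto_integral_of_dominated_convergence (fun x => ‖w x‖)
    (fun m => hw.aestronglyMeasurable.mul (by fun_prop)) hw.norm
    (fun m => ae_of_all _ fun x => ?_) (ae_of_all _ hlim)
  have hmin : |min (1 / ((m : ℝ) + 1) * v x) 1| ≤ 1 := by
    rw [abs_of_nonneg (le_min (mul_nonneg (by positivity) (hv0 x)) zero_le_one)]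
    exact min_le_right _ _
  rw [norm_mul]
  exact mul_le_of_le_one_right (norm_nonneg _) hmin

lemma tendsto_average_mul_min_ae (hX : ∀ i, HasLaw (X i) F P) (hindep : iIndepFun X P)
    {w v : E → ℝ} (hwm : Measurable w) (hw : Integrable w F) (hw0 : ∀ x, 0 ≤ w x)
    (hv : Measurable v) (hv0 : ∀ x, 0 ≤ v x) :
    ∀ᵐ ω ∂P, ∀ δ : ℕ → ℝ, (∀ n, 0 ≤ δ n) → Tendsto δ atTop (𝓝 0) →
      Tendsto (fun n : ℕ => (n : ℝ)⁻¹ * ∑ k ∈ Finset.range n,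
        w (X k ω) * min (δ n * v (X k ω)) 1) atTop (𝓝 0) := by
  have hslln : ∀ m : ℕ, ∀ᵐ ω ∂P, Tendsto (fun n : ℕ => (n : ℝ)⁻¹ • ∑ k ∈ Finset.range n,
      w (X k ω) * min (1 / ((m : ℝ) + 1) * v (X k ω)) 1) atTop
        (𝓝 (∫ x, w x * min (1 / ((m : ℝ) + 1) * v x) 1 ∂F)) := fun m =>
    tendsto_average_ae hX hindep (f := fun x => w x * min (1 / ((m : ℝ) + 1) * v x) 1)
      (by fun_prop) (hw.mono (by fun_prop) (ae_of_all _ fun x => by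
        rw [norm_mul, Real.norm_of_nonneg (le_min (mul_nonneg (by positivity) (hv0 x)) zero_le_one)]
        exact mul_le_of_le_one_right (norm_nonneg _) (min_le_right _ _)))
  filter_upwards [ae_all_iff.2 hslln] with ω hω δ hδ0 hδ
  have hterm : ∀ n k, 0 ≤ w (X k ω) * min (δ n * v (X k ω)) 1 := fun n k =>
    mul_nonneg (hw0 _) (le_min (mul_nonneg (hδ0 n) (hv0 _)) zero_le_one)
  refine tendsto_order.2 ⟨fun a ha => .of_forall fun n => ha.trans_le
    (mul_nonneg (by positivity) (Finset.sum_nonneg fun k _ => hterm n k)), fun ε hε => ?_⟩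
  obtain ⟨m, hm⟩ := ((tendsto_integral_mul_min_div_natCast hw hv hv0).eventually_lt_const hε).exists
  filter_upwards [(hω m).eventually_lt_const hm, hδ.eventually_le_const
    (by positivity : (0 : ℝ) < 1 / ((m : ℝ) + 1))] with n hn hδn
  refine lt_of_le_of_lt ?_ hn
  rw [smul_eq_mul]
  gcongr with k
  · exact hw0 _
  · exact hv0 _

lemma ae_forall_ne [MeasurableSingletonClass E] (hX : ∀ i, HasLaw (X i) F P) {c : E}
    (hc : ∀ᵐ x ∂F, x ≠ c) : ∀ᵐ ω ∂P, ∀ k, X k ω ≠ c :=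
  ae_all_iff.2 fun k => ((hX k).ae_iff (p := (· ≠ c))
    (measurableSet_setOfPred.1 (measurableSet_singleton c).compl)).2 hc

end LawOfLargeNumbers

section AverageSignQuad

variable {Ω H G : Type*} [MeasurableSpace Ω] {P : Measure Ω}
  [NormedAddCommGroup H] [InnerProductSpace ℝ H] [MeasurableSpace H] [BorelSpace H]
  [SecondCountableTopology H] [NormedAddCommGroup G] [NormedSpace ℝ G] [CompleteSpace G]
  {F : Measure H} {X T : ℕ → Ω → H} {c : H} (B : H →L[ℝ] H →L[ℝ] G)

theorem tendsto_average_signQuad_ae [IsFiniteMeasure F] (hX : ∀ i, HasLaw (X i) F P)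
    (hindep : iIndepFun X P) (hc : ∀ᵐ x ∂F, x ≠ c)
    (hT : ∀ᵐ ω ∂P, Tendsto (fun n => T n ω) atTop (𝓝 c)) :
    ∀ᵐ ω ∂P, Tendsto (fun n : ℕ => (n : ℝ)⁻¹ • ∑ k ∈ Finset.range n, signQuad B (X k ω - T n ω))
      atTop (𝓝 (∫ x, signQuad B (x - c) ∂F)) := by
  borelize G
  have hslln := tendsto_average_ae hX hindep ((stronglyMeasurable_signQuad B).measurable.comp
    (measurable_sub_const c)) (integrable_signQuad_sub B F c)
  have hunif := tendsto_average_mul_min_ae hX hindep (w := fun _ => 1) measurable_const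
    (integrable_const _) (fun _ => zero_le_one) (v := fun x => ‖x - c‖⁻¹) (by fun_prop)
    fun _ => by positivity
  filter_upwards [hT, hslln, hunif, ae_forall_ne hX hc] with ω hTω hc_avg hunif hne
  have hδ : Tendsto (fun n => ‖c - T n ω‖) atTop (𝓝 0) := by
    simpa [norm_sub_rev] using tendsto_iff_norm_sub_tendsto_zero.1 hTω
  have hdiff : Tendsto (fun n : ℕ => (n : ℝ)⁻¹ • ∑ k ∈ Finset.range n,
      (signQuad B (X k ω - T n ω) - signQuad B (X k ω - c))) atTop (𝓝 0) := by
    refine squeeze_zero_norm (fun n => norm_average_le n fun k => ?_)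
      (a := fun n : ℕ => (n : ℝ)⁻¹ * ∑ k ∈ Finset.range n, 6 * ‖B‖ *
        (1 * min (‖c - T n ω‖ * ‖X k ω - c‖⁻¹) 1)) ?_
    · simpa using norm_signQuad_add_sub_le B (sub_ne_zero.2 (hne k)) (c - T n ω)
    · simpa [← Finset.mul_sum, mul_left_comm] using
        (hunif _ (fun _ => norm_nonneg _) hδ).const_mul (6 * ‖B‖)
  simpa [Finset.sum_sub_distrib, smul_sub] using hdiff.add hc_avg

theorem isLittleO_average_signQuad_sub_ae (hX : ∀ i, HasLaw (X i) F P) (hindep : iIndepFun X P)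
    (hc : ∀ᵐ x ∂F, x ≠ c) (hint : Integrable (fun x => ‖x - c‖⁻¹) F)
    (hsymm : F.map (fun x => x - c) = F.map (fun x => -(x - c)))
    (hT : ∀ᵐ ω ∂P, Tendsto (fun n => T n ω) atTop (𝓝 c)) :
    ∀ᵐ ω ∂P, (fun n : ℕ => (n : ℝ)⁻¹ • ∑ k ∈ Finset.range n,
      (signQuad B (X k ω - T n ω) - signQuad B (X k ω - c))) =o[atTop] fun n => c - T n ω := by
  have hslln := tendsto_average_ae hX hindep (f := fun x => signQuadDeriv B (x - c))
    ((stronglyMeasurable_signQuadDeriv B).measurable.comp (measurable_sub_const c))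
    (integrable_signQuadDeriv_sub B hint)
  have hunif := tendsto_average_mul_min_ae hX hindep (w := fun x => ‖x - c‖⁻¹)
    (v := fun x => ‖x - c‖⁻¹) (by fun_prop) hint (fun _ => by positivity) (by fun_prop)
    fun _ => by positivity
  filter_upwards [hT, hslln, hunif, ae_forall_ne hX hc] with ω hTω hderiv hunif hne
  have hδ : Tendsto (fun n => ‖c - T n ω‖) atTop (𝓝 0) := by
    simpa [norm_sub_rev] using tendsto_iff_norm_sub_tendsto_zero.1 hTω
  have hfactor : Tendsto (fun n : ℕ =>
      ‖(n : ℝ)⁻¹ • ∑ k ∈ Finset.range n, signQuadDeriv B (X k ω - c)‖ + 14 * ‖B‖ *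
        ((n : ℝ)⁻¹ * ∑ k ∈ Finset.range n,
          ‖X k ω - c‖⁻¹ * min (‖c - T n ω‖ * ‖X k ω - c‖⁻¹) 1)) atTop (𝓝 0) := by
    rw [integral_signQuadDeriv_sub_eq_zero B hsymm] at hderiv
    simpa using hderiv.norm.add ((hunif _ (fun _ => norm_nonneg _) hδ).const_mul (14 * ‖B‖))
  refine (Asymptotics.IsBigO.of_norm_le fun n => ?_).trans_isLittleO <| by
    simpa using ((Asymptotics.isLittleO_one_iff ℝ).2 hfactor).mul_isBigO
      (Asymptotics.isBigO_refl (fun n => ‖c - T n ω‖) atTop)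
  simpa using norm_average_signQuad_add_sub_le B n (fun k => sub_ne_zero.2 (hne k)) (c - T n ω)

end AverageSignQuad

section Slutsky

variable {Ω Ω' E : Type*} [MeasurableSpace Ω] {P : Measure Ω} [IsProbabilityMeasure P]
  [MeasurableSpace Ω'] {P' : Measure Ω'} [IsProbabilityMeasure P']
  [NormedAddCommGroup E] [MeasurableSpace E] [BorelSpace E]

lemma tendstoInMeasure_of_tendstoInDistribution_zero {V : ℕ → Ω → E}
    (h : TendstoInDistribution V atTop (fun _ : Ω' => (0 : E)) (fun _ => P) P') :
    TendstoInMeasure P V atTop 0 := by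
  rw [tendstoInMeasure_iff_norm]
  intro ε hε
  have hcl : IsClosed {x : E | ε ≤ ‖x‖} := isClosed_le continuous_const continuous_norm
  have hlim := ProbabilityMeasure.limsup_measure_closed_le_of_tendsto h.tendsto hcl
  have hzero : (P'.map fun _ => (0 : E)) {x : E | ε ≤ ‖x‖} = 0 := by
    rw [Measure.map_apply measurable_const hcl.measurableSet]
    simp [hε.not_ge]
  have hmap : ∀ n, (P.map (V n)) {x : E | ε ≤ ‖x‖} = P {ω | ε ≤ ‖V n ω - (0 : Ω → E) ω‖} := by
    intro n
    rw [Measure.map_apply_of_aemeasurable (h.forall_aemeasurable n) hcl.measurableSet]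
    simp
  simp only [ProbabilityMeasure.coe_mk, hzero, hmap] at hlim
  exact tendsto_of_le_liminf_of_limsup_le zero_le hlim

variable {H : Type*} [NormedAddCommGroup H] {Z : ℕ → Ω → H} {ζ : Ω' → ℝ}

lemma tendstoInMeasure_zero_of_isLittleO
    (hZ : TendstoInDistribution (fun n ω => ‖Z n ω‖) atTop ζ (fun _ => P) P')
    {V : ℕ → Ω → E} (hV : ∀ n, AEMeasurable (V n) P)
    (h : ∀ᵐ ω ∂P, (fun n => V n ω) =o[atTop] fun n => Z n ω) :
    TendstoInMeasure P V atTop 0 := by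
  have hratio : ∀ n, AEMeasurable (fun ω => ‖V n ω‖ / ‖Z n ω‖) P := fun n =>
    (hV n).norm.div (hZ.forall_aemeasurable n)
  have hratio_lim : TendstoInMeasure P (fun n ω => ‖V n ω‖ / ‖Z n ω‖) atTop fun _ => (0 : ℝ) :=
    tendstoInMeasure_of_tendsto_ae (fun n => (hratio n).aestronglyMeasurable)
      (h.mono fun ω hω => hω.norm_norm.tendsto_div_nhds_zero)
  have hprod := hZ.continuous_comp_prodMk_of_tendstoInMeasure_const
    (g := fun x : ℝ × ℝ => x.2 * x.1) (by fun_prop) hratio_lim hratio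
  simp only [zero_mul] at hprod
  have hsub : TendstoInMeasure P
      ((fun n ω => ‖V n ω‖) - fun n ω => ‖V n ω‖ / ‖Z n ω‖ * ‖Z n ω‖) atTop 0 := by
    refine tendstoInMeasure_of_tendsto_ae (fun n => ((hV n).norm.sub
      ((hratio n).mul (hZ.forall_aemeasurable n))).aestronglyMeasurable) (h.mono fun ω hω => ?_)
    refine tendsto_const_nhds.congr' (hω.norm_norm.eventually_mul_div_cancel.mono fun n hn => ?_)
    exact (sub_eq_zero.2 hn.symm).symm
  have hnorm := tendstoInMeasure_of_tendstoInDistribution_zero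
    (tendstoInDistribution_of_tendstoInMeasure_sub _ _ hprod hsub fun n => (hV n).norm)
  simpa [tendstoInMeasure_iff_norm] using hnorm

theorem tendstoInDistribution_of_isLittleO_sub [SecondCountableTopology E] {Y Y' : ℕ → Ω → E}
    {Ω'' : Type*} [MeasurableSpace Ω''] {P'' : Measure Ω''} [IsProbabilityMeasure P'']
    {η : Ω'' → E} (hY : TendstoInDistribution Y atTop η (fun _ => P) P'')
    (hZ : TendstoInDistribution (fun n ω => ‖Z n ω‖) atTop ζ (fun _ => P) P')
    (hY' : ∀ n, AEMeasurable (Y' n) P)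
    (h : ∀ᵐ ω ∂P, (fun n => Y' n ω - Y n ω) =o[atTop] fun n => Z n ω) :
    TendstoInDistribution Y' atTop η (fun _ => P) P'' :=
  tendstoInDistribution_of_tendstoInMeasure_sub Y' η hY
    (tendstoInMeasure_zero_of_isLittleO hZ (fun n => (hY' n).sub (hY.forall_aemeasurable n)) h) hY'

end Slutsky

section CentralLimitTheorem

variable {Ω E ι : Type*} [MeasurableSpace Ω] {P : Measure Ω} [MeasurableSpace E] {F : Measure E}
  [Fintype ι]

/-- The covariance matrix `(Cov(Zᵢ, Zⱼ))ᵢⱼ` of a random vector `Z`. -/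
def covMatrix (F : Measure E) (Z : E → EuclideanSpace ℝ ι) : Matrix ι ι ℝ :=
  Matrix.of fun i j => cov[fun x => Z x i, fun x => Z x j; F]

lemma variance_inner_eq_dotProduct_covMatrix [IsFiniteMeasure F] {Z : E → EuclideanSpace ℝ ι}
    (hZ : MemLp Z 2 F) (t : EuclideanSpace ℝ ι) :
    Var[fun x => inner ℝ (Z x) t; F] = t.ofLp ⬝ᵥ covMatrix F Z *ᵥ t.ofLp := by
  have hterm : ∀ i, MemLp (fun x => t i * Z x i) 2 F := fun i => (hZ.eval_piLp i).const_mul _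
  simp only [PiLp.inner_apply, RCLike.inner_apply, conj_trivial]
  rw [variance_fun_sum hterm]
  simp only [dotProduct, Matrix.mulVec, covMatrix, Matrix.of_apply, Finset.mul_sum]
  refine Finset.sum_congr rfl fun i _ => Finset.sum_congr rfl fun j _ => ?_
  rw [covariance_const_mul_left, covariance_const_mul_right]
  ring

lemma posSemidef_covMatrix [IsFiniteMeasure F] {Z : E → EuclideanSpace ℝ ι} (hZ : MemLp Z 2 F) :
    (covMatrix F Z).PosSemidef := by
  refine Matrix.PosSemidef.of_dotProduct_mulVec_nonneg ?_ fun x => ?_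
  · ext i j
    simp [covMatrix, covariance_comm]
  · rw [star_trivial]
    exact (variance_nonneg _ _).trans_eq
      (variance_inner_eq_dotProduct_covMatrix hZ (WithLp.toLp 2 x))

variable [IsProbabilityMeasure P] [DecidableEq ι]

theorem tendstoInDistribution_multivariateGaussian {Y : ℕ → Ω → EuclideanSpace ℝ ι}
    {S : Matrix ι ι ℝ} (hS : S.PosSemidef) (hY : ∀ n, AEMeasurable (Y n) P)
    (h : ∀ t : EuclideanSpace ℝ ι, TendstoInDistribution (fun n ω => inner ℝ (Y n ω) t) atTop id
      (fun _ => P) (gaussianReal 0 (t.ofLp ⬝ᵥ S *ᵥ t.ofLp).toNNReal)) :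
    TendstoInDistribution Y atTop id (fun _ => P) (multivariateGaussian 0 S) := by
  refine ⟨hY, aemeasurable_id, ProbabilityMeasure.tendsto_iff_tendsto_charFun.2 fun t => ?_⟩
  have hchar := ProbabilityMeasure.tendsto_iff_tendsto_charFun.1 (h t).tendsto 1
  have hvar : 0 ≤ t.ofLp ⬝ᵥ S *ᵥ t.ofLp := by
    simpa only [star_trivial] using hS.dotProduct_mulVec_nonneg t.ofLp
  simp only [ProbabilityMeasure.coe_mk, Measure.map_id, charFun_gaussianReal,
    charFun_multivariateGaussian hS] at hchar ⊢
  convert hchar using 2 with n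
  · rw [charFun_apply, charFun_apply_real, integral_map (hY n) (by fun_prop),
      integral_map ((h t).forall_aemeasurable n) (by fun_prop)]
    simp
  · simp [hvar]

theorem tendstoInDistribution_sqrt_smul_average_sub [IsFiniteMeasure F] {X : ℕ → Ω → E}
    (hX : ∀ i, HasLaw (X i) F P) (hindep : iIndepFun X P) {f : E → EuclideanSpace ℝ ι}
    (hf : Measurable f) (hf2 : MemLp f 2 F) :
    TendstoInDistribution (fun (n : ℕ) ω => √(n : ℝ) •
        ((n : ℝ)⁻¹ • ∑ k ∈ Finset.range n, f (X k ω) - ∫ x, f x ∂F))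
      atTop id (fun _ => P) (multivariateGaussian 0 (covMatrix F f)) := by
  have hXm := fun i => (hX i).aemeasurable
  refine tendstoInDistribution_multivariateGaussian (posSemidef_covMatrix hf2)
    (fun n => by fun_prop) fun t => ?_
  have hmeas : Measurable fun x => inner ℝ (f x) t := by fun_prop
  have hmean : P[fun ω => inner ℝ (f (X 0 ω)) t] = inner ℝ (∫ x, f x ∂F) t := by
    refine ((hX 0).integral_comp (f := fun x => inner ℝ (f x) t)
      hmeas.aestronglyMeasurable).trans ?_
    simp_rw [real_inner_comm t]
    exact integral_inner (hf2.integrable one_le_two) t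
  have hvar : Var[fun ω => inner ℝ (f (X 0 ω)) t; P] = t.ofLp ⬝ᵥ covMatrix F f *ᵥ t.ofLp := by
    rw [← variance_inner_eq_dotProduct_covMatrix hf2, ← (hX 0).map_eq,
      variance_map hmeas.aemeasurable (hX 0).aemeasurable]
    rfl
  have hmem : MemLp (fun ω => inner ℝ (f (X 0 ω)) t) 2 P :=
    ((hX 0).map_eq.symm ▸ hf2.inner_const t).comp_of_map (hX 0).aemeasurable
  have hclt := tendstoInDistribution_inv_sqrt_mul_sum_sub (P := P)
    (X := fun i ω => inner ℝ (f (X i ω)) t) (Y := id) (HasLaw.id (μ := gaussianReal 0 _))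
    hmem (hindep.comp (fun _ x => inner ℝ (f x) t) fun _ => hmeas)
    fun i => ((hX i).identDistrib (hX 0)).comp hmeas
  rw [hmean, hvar] at hclt
  refine hclt.congr (fun n => ae_of_all _ fun ω => ?_) .rfl
  rcases n.eq_zero_or_pos with rfl | hn
  · simp
  have hn' : (0 : ℝ) < n := Nat.cast_pos.2 hn
  simp only [real_inner_smul_left, inner_sub_left, sum_inner]
  field_simp
  rw [Real.sq_sqrt hn'.le]

end CentralLimitTheorem

section InverseMoment

variable {E : Type*} [NormedAddCommGroup E] [MeasurableSpace E] [BorelSpace E] {F : Measure E}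
  {c : E}

lemma ae_ne_of_lintegral_enorm_inv_lt_top (hF : ∫⁻ x, ‖x - c‖ₑ⁻¹ ∂F < ∞) : ∀ᵐ x ∂F, x ≠ c := by
  filter_upwards [ae_lt_top (by fun_prop) hF.ne] with x hx hxc
  rw [hxc, sub_self, enorm_zero, ENNReal.inv_zero] at hx
  exact lt_irrefl _ hx

lemma integrable_inv_norm_sub (hF : ∫⁻ x, ‖x - c‖ₑ⁻¹ ∂F < ∞) :
    Integrable (fun x => ‖x - c‖⁻¹) F := by
  refine ⟨(by fun_prop : Measurable fun x => ‖x - c‖⁻¹).aestronglyMeasurable,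
    (lintegral_mono fun x => ?_).trans_lt hF⟩
  rw [Real.enorm_of_nonneg (inv_nonneg.2 (norm_nonneg _)), ← ofReal_norm]
  exact ENNReal.ofReal_inv_le

end InverseMoment

section SpatialSignCovariance

variable {Ω : Type*} [MeasurableSpace Ω] {P : Measure Ω} {p : ℕ}
  {F : Measure (EuclideanSpace ℝ (Fin p))} {c : EuclideanSpace ℝ (Fin p)}
  {X T : ℕ → Ω → EuclideanSpace ℝ (Fin p)}

/-- The vectorized outer product `(u, v) ↦ vec (u vᵀ)`. -/
def vecOuter (p : ℕ) : EuclideanSpace ℝ (Fin p) →L[ℝ] EuclideanSpace ℝ (Fin p) →L[ℝ]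
    EuclideanSpace ℝ (Fin p × Fin p) :=
  (LinearMap.mk₂ ℝ (fun u v => vecE (Matrix.vecMulVec u.ofLp v.ofLp))
    (fun _ _ _ => by simp [vecE, Matrix.add_vecMulVec])
    (fun _ _ _ => by simp [vecE, Matrix.smul_vecMulVec])
    (fun _ _ _ => by simp [vecE, Matrix.vecMulVec_add])
    (fun _ _ _ => by simp [vecE, Matrix.vecMulVec_smul])).toContinuousBilinearMap

/-- The spatial sign covariance matrix `E(s(X - c) s(X - c)ᵀ)` with respect to an arbitrary
location `c`, entry by entry. -/
def sscmAt (F : Measure (EuclideanSpace ℝ (Fin p))) (c : EuclideanSpace ℝ (Fin p)) :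
    Matrix (Fin p) (Fin p) ℝ :=
  Matrix.of fun i j => ∫ x, signOuter (x - c) i j ∂F

/-- The covariance matrix of `vec (s(X - c) s(X - c)ᵀ)`, where `X` has distribution `F`. -/
def signCov (F : Measure (EuclideanSpace ℝ (Fin p))) (c : EuclideanSpace ℝ (Fin p)) :
    Matrix (Fin p × Fin p) (Fin p × Fin p) ℝ :=
  covMatrix F fun x => vecE (signOuter (x - c))

lemma signQuad_vecOuter (y : EuclideanSpace ℝ (Fin p)) :
    signQuad (vecOuter p) y = vecE (signOuter y) := by
  ext q
  simp only [signQuad, vecOuter, vecE, signOuter, spatialSign, Matrix.vec, WithLp.ofLp_smul,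
    Matrix.vecMulVec_apply, LinearMap.toContinuousBilinearMap_apply, LinearMap.mk₂_apply,
    PiLp.smul_apply, Pi.smul_apply, smul_eq_mul]
  ring

lemma vecE_empiricalSSCM (n : ℕ) (x : ℕ → EuclideanSpace ℝ (Fin p)) (t : EuclideanSpace ℝ (Fin p)) :
    vecE (empiricalSSCM (fun i : Fin n => x i) t) =
      (n : ℝ)⁻¹ • ∑ k ∈ Finset.range n, signQuad (vecOuter p) (x k - t) := by
  simp only [signQuad_vecOuter, empiricalSSCM,
    Fin.sum_univ_eq_sum_range (fun k => signOuter (x k - t)) n]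
  ext q
  simp [vecE, Matrix.vec, Matrix.sum_apply]

lemma vecE_sscmAt [IsFiniteMeasure F] :
    vecE (sscmAt F c) = ∫ x, signQuad (vecOuter p) (x - c) ∂F := by
  have hint := integrable_signQuad_sub (vecOuter p) F c
  simp only [signQuad_vecOuter] at hint ⊢
  ext q
  exact (EuclideanSpace.proj (𝕜 := ℝ) q).integral_comp_comm hint

lemma vecE_sub (A A' : Matrix (Fin p) (Fin p) ℝ) : vecE (A - A') = vecE A - vecE A' :=
  rfl

theorem tendsto_empiricalSSCM_ae [IsFiniteMeasure F] (hX : ∀ i, HasLaw (X i) F P)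
    (hindep : iIndepFun X P) (hc : ∀ᵐ x ∂F, x ≠ c)
    (hT : ∀ᵐ ω ∂P, Tendsto (fun n => T n ω) atTop (𝓝 c)) :
    ∀ᵐ ω ∂P, Tendsto (fun n : ℕ => empiricalSSCM (fun i : Fin n => X i ω) (T n ω)) atTop
      (𝓝 (sscmAt F c)) := by
  filter_upwards [tendsto_average_signQuad_ae (vecOuter p) hX hindep hc hT] with ω hω
  simp only [← vecE_sscmAt, ← vecE_empiricalSSCM _ (fun k => X k ω)] at hω
  refine tendsto_pi_nhds.2 fun i => tendsto_pi_nhds.2 fun j => ?_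
  exact ((EuclideanSpace.proj (𝕜 := ℝ) (j, i)).continuous.tendsto _).comp hω

lemma memLp_signQuad_sub [IsFiniteMeasure F] :
    MemLp (fun x => signQuad (vecOuter p) (x - c)) 2 F :=
  .of_bound ((stronglyMeasurable_signQuad _).comp_measurable
    (measurable_sub_const c)).aestronglyMeasurable _ (ae_of_all _ fun _ => norm_signQuad_le _ _)

lemma posSemidef_signCov [IsFiniteMeasure F] : (signCov F c).PosSemidef := by
  simpa only [signCov, signQuad_vecOuter] using
    posSemidef_covMatrix (memLp_signQuad_sub (F := F) (c := c))

variable [IsProbabilityMeasure P]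

theorem tendstoInDistribution_sqrt_smul_empiricalSSCM [IsFiniteMeasure F]
    (hX : ∀ i, HasLaw (X i) F P) (hindep : iIndepFun X P) (hc : ∀ᵐ x ∂F, x ≠ c)
    (hint : Integrable (fun x => ‖x - c‖⁻¹) F)
    (hsymm : F.map (fun x => x - c) = F.map (fun x => -(x - c)))
    (hTmeas : ∀ n, AEMeasurable (T n) P) (hT : ∀ᵐ ω ∂P, Tendsto (fun n => T n ω) atTop (𝓝 c))
    {Ω' : Type*} [MeasurableSpace Ω'] {P' : Measure Ω'} [IsProbabilityMeasure P'] {ζ : Ω' → ℝ}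
    (hζ : TendstoInDistribution (fun (n : ℕ) ω => √(n : ℝ) * ‖T n ω - c‖) atTop ζ
      (fun _ => P) P') :
    TendstoInDistribution (fun (n : ℕ) ω => √(n : ℝ) •
        vecE (empiricalSSCM (fun i : Fin n => X i ω) (T n ω) - sscmAt F c))
      atTop id (fun _ => P) (multivariateGaussian 0 (signCov F c)) := by
  have hmeas := (stronglyMeasurable_signQuad (vecOuter p)).measurable
  have hclt := tendstoInDistribution_sqrt_smul_average_sub hX hindep
    (f := fun x => signQuad (vecOuter p) (x - c)) (by fun_prop) memLp_signQuad_sub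
  have hZ : TendstoInDistribution (fun (n : ℕ) ω => ‖√(n : ℝ) • (c - T n ω)‖) atTop ζ
      (fun _ => P) P' := by
    simpa only [norm_smul, Real.norm_of_nonneg (Real.sqrt_nonneg _), norm_sub_rev c] using hζ
  have hXm := fun i => (hX i).aemeasurable
  have hY' : ∀ n : ℕ, AEMeasurable (fun ω => √(n : ℝ) •
      vecE (empiricalSSCM (fun i : Fin n => X i ω) (T n ω) - sscmAt F c)) P := by
    intro n
    simp only [vecE_sub, fun ω => vecE_empiricalSSCM n (fun k => X k ω) (T n ω)]
    fun_prop
  simp only [signCov, ← signQuad_vecOuter]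
  refine tendstoInDistribution_of_isLittleO_sub hclt hZ hY' ?_
  filter_upwards [isLittleO_average_signQuad_sub_ae (vecOuter p) hX hindep hc hint hsymm hT]
    with ω hω
  refine ((Asymptotics.isBigO_refl (fun n : ℕ => √(n : ℝ)) atTop).smul_isLittleO hω).congr_left
    fun n => ?_
  rw [vecE_sub, vecE_empiricalSSCM n (fun k => X k ω), vecE_sscmAt, ← smul_sub,
    sub_sub_sub_cancel_right, ← smul_sub, Finset.sum_sub_distrib]

end SpatialSignCovariance

section SymmetryCenter

variable {E : Type*} [NormedAddCommGroup E] [MeasurableSpace E] [BorelSpace E] {F : Measure E}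

lemma map_add_sub_eq_self {c : E} (hsymm : F.map (fun x => x - c) = F.map (fun x => -(x - c))) :
    F.map (fun x => c + c - x) = F := by
  have h := congrArg (Measure.map fun y => y + c) hsymm
  rw [Measure.map_map (by fun_prop) (by fun_prop),
    Measure.map_map (by fun_prop) (by fun_prop)] at h
  have hid : (fun y => y + c) ∘ (fun x => x - c) = id := funext fun x => sub_add_cancel x c
  have hrefl : (fun y => y + c) ∘ (fun x => -(x - c)) = fun x => c + c - x := by
    funext x
    simp only [Function.comp_apply]
    abel
  rw [hid, hrefl, Measure.map_id] at h
  exact h.symm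

variable [NormedSpace ℝ E]

-- By Poincaré recurrence almost every point returns to a ball infinitely often under `x ↦ x + v`.
lemma eq_zero_of_map_add_right_eq [IsFiniteMeasure F] [NeZero F] {v : E}
    (h : F.map (fun x => x + v) = F) : v = 0 := by
  by_contra hv
  have hcons : Conservative (fun x => x + v) F := MeasurePreserving.conservative ⟨by fun_prop, h⟩
  have hrec : ∀ᵐ x ∂F, ∀ R : ℕ, x ∈ Metric.closedBall (0 : E) R →
      ∃ᶠ n in atTop, (fun x => x + v)^[n] x ∈ Metric.closedBall (0 : E) R :=
    ae_all_iff.2 fun R => hcons.ae_mem_imp_frequently_image_mem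
      Metric.isClosed_closedBall.measurableSet.nullMeasurableSet
  obtain ⟨x, hx⟩ := hrec.exists
  obtain ⟨R, hR⟩ := exists_nat_ge ‖x‖
  refine hx R (mem_closedBall_zero_iff.2 hR) ?_
  have hlim : Tendsto (fun n : ℕ => (n : ℝ) * ‖v‖) atTop atTop :=
    tendsto_natCast_atTop_atTop.atTop_mul_const (norm_pos_iff.2 hv)
  filter_upwards [hlim.eventually_gt_atTop (2 * R : ℝ)] with n hn hmem
  rw [add_right_iterate, mem_closedBall_zero_iff] at hmem
  have hle : ‖n • v‖ ≤ ‖x + n • v‖ + ‖x‖ := by simpa using norm_sub_le (x + n • v) x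
  rw [← Nat.cast_smul_eq_nsmul ℝ, norm_smul, Real.norm_natCast] at hle
  rw [← Nat.cast_smul_eq_nsmul ℝ] at hmem
  linarith

lemma eq_of_map_add_sub_eq_self [IsFiniteMeasure F] [NeZero F] {c m : E}
    (hc : F.map (fun x => c + c - x) = F) (hm : F.map (fun x => m + m - x) = F) : c = m := by
  have htrans : F.map (fun x => x + (2 : ℝ) • (c - m)) = F := by
    conv_rhs => rw [← hc, ← hm]
    rw [Measure.map_map (by fun_prop) (by fun_prop)]
    congr 1
    funext x
    simp only [Function.comp_apply]
    module
  have hzero := eq_zero_of_map_add_right_eq htrans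
  exact sub_eq_zero.1 ((smul_eq_zero.1 hzero).resolve_left two_ne_zero)

end SymmetryCenter

section Elliptical

variable {p : ℕ} {F : Measure (EuclideanSpace ℝ (Fin p))} {m : EuclideanSpace ℝ (Fin p)}
  {V : Matrix (Fin p) (Fin p) ℝ}

lemma IsElliptical.map_add_sub_eq_self (h : IsElliptical F m V) :
    F.map (fun x => m + m - x) = F := by
  obtain ⟨-, g, hg, -, rfl⟩ := h
  have hmp : MeasurePreserving (fun x : EuclideanSpace ℝ (Fin p) => m + m - x) volume volume :=
    Measure.measurePreserving_sub_left volume (m + m)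
  ext s hs
  rw [Measure.map_apply hmp.measurable hs, withDensity_apply _ (hmp.measurable hs),
    withDensity_apply _ hs, ← hmp.setLIntegral_comp_preimage hs]
  · refine lintegral_congr fun x => ?_
    have hneg : m + m - x - m = -(x - m) := by abel
    rw [hneg, WithLp.ofLp_neg, Matrix.mulVec_neg, neg_dotProduct_neg]
  · simp only [dotProduct, Matrix.mulVec]
    fun_prop

lemma IsElliptical.ae_ne [NeZero p] (h : IsElliptical F m V) (c : EuclideanSpace ℝ (Fin p)) :
    ∀ᵐ x ∂F, x ≠ c := by
  obtain ⟨-, g, -, -, rfl⟩ := h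
  exact (withDensity_absolutelyContinuous _ _).ae_le (Measure.ae_ne volume c)

lemma integral_comp_linearMap {E G : Type*} [NormedAddCommGroup E] [NormedSpace ℝ E]
    [FiniteDimensional ℝ E] [MeasurableSpace E] [BorelSpace E] [NormedAddCommGroup G]
    [NormedSpace ℝ G] (μ : Measure E) [μ.IsAddHaarMeasure] {L : E →ₗ[ℝ] E}
    (hL : LinearMap.det L ≠ 0) (f : E → G) :
    ∫ x, f (L x) ∂μ = |LinearMap.det L|⁻¹ • ∫ y, f y ∂μ := by
  have hemb : MeasurableEmbedding L :=
    (L.equivOfDetNeZero hL).toContinuousLinearEquiv.toHomeomorph.measurableEmbedding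
  rw [← hemb.integral_map, Measure.map_linearMap_addHaar_eq_smul_addHaar μ hL,
    integral_smul_measure, ENNReal.toReal_ofReal (abs_nonneg _), abs_inv]

lemma dotProduct_inv_mulVec_toEuclideanLin {A : Matrix (Fin p) (Fin p) ℝ} (hA : IsUnit A.det)
    (z : EuclideanSpace ℝ (Fin p)) :
    (Matrix.toEuclideanLin A z).ofLp ⬝ᵥ ((A * Aᵀ)⁻¹ *ᵥ (Matrix.toEuclideanLin A z).ofLp) =
      ‖z‖ ^ 2 := by
  rw [Matrix.ofLp_toLpLin, Matrix.toLin'_apply, Matrix.mulVec_mulVec, Matrix.mul_inv_rev,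
    Matrix.mul_assoc, Matrix.nonsing_inv_mul _ hA, Matrix.mul_one, ← Matrix.vecMul_transpose A,
    ← Matrix.dotProduct_mulVec, Matrix.mulVec_mulVec,
    Matrix.mul_nonsing_inv _ (by rwa [Matrix.det_transpose]), Matrix.one_mulVec,
    EuclideanSpace.real_norm_sq_eq]
  simp only [dotProduct, sq]

lemma IsElliptical.exists_integral_eq (G : Type*) [NormedAddCommGroup G] [NormedSpace ℝ G]
    {A : Matrix (Fin p) (Fin p) ℝ} (h : IsElliptical F m (A * Aᵀ)) :
    ∃ g : ℝ → ℝ, ∀ f : EuclideanSpace ℝ (Fin p) → G,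
      ∫ x, f (x - m) ∂F = ∫ z, g (‖z‖ ^ 2) • f (Matrix.toEuclideanLin A z) := by
  obtain ⟨hpos, g, hg, hg0, rfl⟩ := h
  have hdet : (A * Aᵀ).det = A.det ^ 2 := by rw [Matrix.det_mul, Matrix.det_transpose, sq]
  have hA : A.det ≠ 0 := fun h0 => hpos.det_pos.ne' (by rw [hdet, h0, zero_pow two_ne_zero])
  have hdetL : LinearMap.det (Matrix.toEuclideanLin A) = A.det := LinearMap.det_toLpLin _ _
  refine ⟨g, fun f => ?_⟩
  have hdens : ∀ x : EuclideanSpace ℝ (Fin p),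
      0 ≤ (√(A * Aᵀ).det)⁻¹ * g (x.ofLp ⬝ᵥ ((A * Aᵀ)⁻¹ *ᵥ x.ofLp)) :=
    fun x => mul_nonneg (by positivity) (hg0 _)
  rw [integral_withDensity_eq_integral_toReal_smul
    (by simp only [dotProduct, Matrix.mulVec]; fun_prop)
    (ae_of_all _ fun _ => ENNReal.ofReal_lt_top)]
  simp_rw [ENNReal.toReal_ofReal (hdens _)]
  rw [integral_sub_right_eq_self (μ := volume) (fun y : EuclideanSpace ℝ (Fin p) =>
    ((√(A * Aᵀ).det)⁻¹ * g (y.ofLp ⬝ᵥ ((A * Aᵀ)⁻¹ *ᵥ y.ofLp))) • f y) m]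
  have hsubst := integral_comp_linearMap volume (hdetL.trans_ne hA) fun y =>
    g (y.ofLp ⬝ᵥ ((A * Aᵀ)⁻¹ *ᵥ y.ofLp)) • f y
  simp_rw [dotProduct_inv_mulVec_toEuclideanLin hA.isUnit] at hsubst
  simp_rw [hsubst, hdetL, mul_smul, integral_smul, hdet, Real.sqrt_sq_eq_abs]

end Elliptical

section UnitCircle

variable {α : Type*} [MeasurableSpace α] {F : Measure α}

lemma covariance_congr_ae {X X' Y Y' : α → ℝ} (hX : X =ᵐ[F] X') (hY : Y =ᵐ[F] Y') :
    cov[X, Y; F] = cov[X', Y'; F] := by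
  rw [covariance, covariance, integral_congr_ae hX, integral_congr_ae hY]
  refine integral_congr_ae ?_
  filter_upwards [hX, hY] with x hx hy
  rw [hx, hy]

lemma re_mul_mul_re_mul (u v z : ℂ) :
    (u * z).re * (v * z).re =
      ((u * v * z ^ 2).re + (u * starRingEnd ℂ v).re * ‖z‖ ^ 2) / 2 := by
  rw [Complex.sq_norm, Complex.normSq_apply]
  simp only [sq, Complex.mul_re, Complex.mul_im, Complex.conj_re, Complex.conj_im]
  ring

lemma covariance_re_mul [IsProbabilityMeasure F] {ζ : α → ℂ} (hζ : AEStronglyMeasurable ζ F)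
    (hnorm : ∀ᵐ x ∂F, ‖ζ x‖ = 1) (hsq : ∫ x, ζ x ^ 2 ∂F = (∫ x, ζ x ∂F) ^ 2) (u v : ℂ) :
    cov[fun x => (u * ζ x).re, fun x => (v * ζ x).re; F] =
      (1 - ‖∫ x, ζ x ∂F‖ ^ 2) / 2 * (u * starRingEnd ℂ v).re := by
  have hL : MemLp ζ 2 F := .of_bound hζ 1 (hnorm.mono fun x hx => hx.le)
  have hζ2 : Integrable (fun x => ζ x ^ 2) F :=
    .of_bound (hζ.pow 2) 1 (hnorm.mono fun x hx => by rw [norm_pow, hx, one_pow])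
  have hre : ∀ w : ℂ, MemLp (fun x => (w * ζ x).re) 2 F := fun w =>
    Complex.reCLM.comp_memLp' (hL.const_mul w)
  have hint : ∀ (w : ℂ) {f : α → ℂ}, Integrable f F →
      ∫ x, (w * f x).re ∂F = (w * ∫ x, f x ∂F).re := fun w f hf => by
    rw [← integral_const_mul]
    exact Complex.reCLM.integral_comp_comm (hf.const_mul w)
  have hprod : ∀ᵐ x ∂F, (u * ζ x).re * (v * ζ x).re =
      ((u * v * ζ x ^ 2).re + (u * starRingEnd ℂ v).re) / 2 := by
    filter_upwards [hnorm] with x hx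
    rw [re_mul_mul_re_mul, hx, one_pow, mul_one]
  have hintsq : Integrable (fun x => (u * v * ζ x ^ 2).re) F := (hζ2.const_mul (u * v)).re
  have hEprod : ∫ x, (u * ζ x).re * (v * ζ x).re ∂F =
      ((u * v * (∫ x, ζ x ∂F) ^ 2).re + (u * starRingEnd ℂ v).re) / 2 := by
    rw [integral_congr_ae hprod, integral_div, integral_add hintsq (integrable_const _),
      hint _ hζ2, hsq, integral_const, probReal_univ, one_smul]
  rw [covariance_eq_sub (hre u) (hre v), hint u (hL.integrable one_le_two),
    hint v (hL.integrable one_le_two), re_mul_mul_re_mul]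
  simp only [Pi.mul_apply]
  rw [hEprod]
  ring

end UnitCircle

section SquaredDirection

/-- The square `e^{2iθ}` of the direction of `z = r e^{iθ}`, with the value `0` at `z = 0`. Up to
an affine map it is the matrix `s(y) s(y)ᵀ` of the corresponding vector `y` of the plane. -/
def sqDirection (z : ℂ) : ℂ :=
  z / starRingEnd ℂ z

lemma sqDirection_ofReal_mul {r : ℝ} (hr : r ≠ 0) (z : ℂ) :
    sqDirection (r * z) = sqDirection z := by
  rw [sqDirection, map_mul, Complex.conj_ofReal, mul_div_mul_left _ _ (Complex.ofReal_ne_zero.2 hr),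
    sqDirection]

lemma norm_sqDirection {z : ℂ} (hz : z ≠ 0) : ‖sqDirection z‖ = 1 := by
  rw [sqDirection, norm_div, Complex.norm_conj, div_self (norm_ne_zero_iff.2 hz)]

lemma sqDirection_mul_sq_norm (z : ℂ) : sqDirection z * (‖z‖ : ℂ) ^ 2 = z ^ 2 := by
  rcases eq_or_ne z 0 with rfl | hz
  · simp
  · rw [← Complex.mul_conj', sqDirection, sq]
    field_simp [(map_ne_zero (starRingEnd ℂ)).2 hz]

lemma measurable_sqDirection : Measurable sqDirection :=
  measurable_id.div Complex.continuous_conj.measurable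

lemma one_add_mul_sq_ne_zero {κ : ℝ} (hκ : |κ| < 1) {w : ℂ} (hw : ‖w‖ ≤ 1) :
    1 + (κ : ℂ) * w ^ 2 ≠ 0 := by
  intro h
  have hnorm : ‖(κ : ℂ) * w ^ 2‖ = 1 := by
    rw [← norm_neg, ← eq_neg_of_add_eq_zero_left h, norm_one]
  refine hnorm.not_lt ?_
  rw [norm_mul, norm_pow, Complex.norm_real, Real.norm_eq_abs]
  exact mul_lt_one_of_nonneg_of_lt_one_left (abs_nonneg κ) hκ (pow_le_one₀ (norm_nonneg w) hw)

lemma circleAverage_blaschke_pow {κ : ℝ} (hκ : |κ| < 1) (k : ℕ) :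
    Real.circleAverage (fun w : ℂ => ((w ^ 2 + κ) / (1 + κ * w ^ 2)) ^ k) 0 1 = (κ : ℂ) ^ k := by
  have hdiff : DiffContOnCl ℂ (fun w : ℂ => ((w ^ 2 + κ) / (1 + κ * w ^ 2)) ^ k)
      (Metric.ball 0 |1|) := by
    rw [abs_one]
    refine DifferentiableOn.diffContOnCl_ball (U := Metric.closedBall 0 1) (fun w hw => ?_) le_rfl
    have hden := one_add_mul_sq_ne_zero hκ (mem_closedBall_zero_iff.1 hw)
    fun_prop (disch := exact hden)
  simpa using hdiff.circleAverage

lemma sqDirection_ellipse {a b : ℝ} (hab : a + b ≠ 0) {w : ℂ} (hw : ‖w‖ = 1) :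
    sqDirection ⟨a * w.re, b * w.im⟩ =
      (w ^ 2 + ((a - b) / (a + b) : ℝ)) / (1 + ((a - b) / (a + b) : ℝ) * w ^ 2) := by
  have habC : (a : ℂ) + b ≠ 0 := by exact_mod_cast hab
  have hw0 : w ≠ 0 := norm_ne_zero_iff.1 (hw.symm ▸ one_ne_zero)
  have hconj : w * starRingEnd ℂ w = 1 := by rw [Complex.mul_conj', hw, Complex.ofReal_one, one_pow]
  have hz : 2 * (⟨a * w.re, b * w.im⟩ : ℂ) = (a + b) * w + (a - b) * starRingEnd ℂ w := by
    rw [Complex.mk_eq_add_mul_I]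
    push_cast [Complex.re_eq_add_conj, Complex.im_eq_sub_conj]
    field_simp
    ring
  have hz' : 2 * starRingEnd ℂ ⟨a * w.re, b * w.im⟩ = (a + b) * starRingEnd ℂ w + (a - b) * w := by
    simpa only [map_add, map_sub, map_mul, Complex.conj_ofReal, Complex.conj_conj, map_ofNat]
      using congrArg (starRingEnd ℂ) hz
  have hnum : w * (2 * (⟨a * w.re, b * w.im⟩ : ℂ)) =
      (a + b) * (w ^ 2 + ((a - b) / (a + b) : ℝ)) := by
    rw [hz]
    push_cast
    field_simp
    linear_combination (a - b : ℂ) * hconj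
  have hden : w * (2 * starRingEnd ℂ ⟨a * w.re, b * w.im⟩) =
      (a + b) * (1 + ((a - b) / (a + b) : ℝ) * w ^ 2) := by
    rw [hz']
    push_cast
    field_simp
    linear_combination (a + b : ℂ) * hconj
  rw [sqDirection, ← mul_div_mul_left _ _ two_ne_zero, ← mul_div_mul_left _ _ hw0, hnum, hden,
    mul_div_mul_left _ _ habC]

lemma circleAverage_sqDirection_pow {a b : ℝ} (ha : 0 < a) (hb : 0 < b) (k : ℕ) :
    Real.circleAverage (fun w => sqDirection ⟨a * w.re, b * w.im⟩ ^ k) 0 1 =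
      (((a - b) / (a + b) : ℝ) : ℂ) ^ k := by
  have hκ : |(a - b) / (a + b)| < 1 := by
    rw [abs_div, abs_of_pos (add_pos ha hb), div_lt_one (add_pos ha hb), abs_lt]
    constructor <;> linarith
  rw [← circleAverage_blaschke_pow hκ]
  refine Real.circleAverage_congr_sphere fun w hw => ?_
  rw [abs_one, mem_sphere_zero_iff_norm] at hw
  simp only [sqDirection_ellipse (add_pos ha hb).ne' hw]

lemma integral_radial_smul {G : Type*} [NormedAddCommGroup G] [NormedSpace ℝ G] (g : ℝ → ℝ)
    {f : ℂ → G} (hf : ∀ r : ℝ, 0 < r → ∀ z, f (r * z) = f z) :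
    ∫ z : ℂ, g ‖z‖ • f z =
      ((2 * Real.pi) * ∫ r in Set.Ioi (0 : ℝ), r * g r) • Real.circleAverage f 0 1 := by
  have havg : ∫ θ in Set.Ioo (-Real.pi) Real.pi, f (Real.cos θ + Real.sin θ * Complex.I) =
      (2 * Real.pi) • Real.circleAverage f 0 1 := by
    rw [Real.circleAverage_eq_integral_add (-Real.pi), smul_inv_smul₀ Real.two_pi_pos.ne',
      intervalIntegral.integral_comp_add_right (fun θ => f (circleMap 0 1 θ)), zero_add,
      two_mul, add_neg_cancel_right, intervalIntegral.integral_of_le (by linarith [Real.pi_pos]),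
      integral_Ioc_eq_integral_Ioo]
    simp only [circleMap_zero, Complex.ofReal_one, one_mul, Complex.exp_mul_I, Complex.ofReal_cos,
      Complex.ofReal_sin]
  have hpolar : ∀ q ∈ Set.Ioi (0 : ℝ) ×ˢ Set.Ioo (-Real.pi) Real.pi,
      q.1 • g ‖Complex.polarCoord.symm q‖ • f (Complex.polarCoord.symm q) =
        (q.1 * g q.1) • f (Real.cos q.2 + Real.sin q.2 * Complex.I) := fun q hq => by
    have hr : 0 < q.1 := hq.1
    rw [Complex.norm_polarCoord_symm, abs_of_pos hr, Complex.polarCoord_symm_apply, hf q.1 hr,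
      smul_smul]
  rw [← Complex.integral_comp_polarCoord_symm, polarCoord_target,
    setIntegral_congr_fun (measurableSet_Ioi.prod measurableSet_Ioo) hpolar,
    Measure.volume_eq_prod, ← Measure.prod_restrict,
    integral_prod_smul (fun r : ℝ => r * g r)
      (fun θ : ℝ => f (Real.cos θ + Real.sin θ * Complex.I)), havg, smul_smul,
    mul_comm (2 * Real.pi)]

end SquaredDirection

section Planar

variable {F : Measure (EuclideanSpace ℝ (Fin 2))} {m : EuclideanSpace ℝ (Fin 2)}
  {U : Matrix (Fin 2) (Fin 2) ℝ} {lam : Fin 2 → ℝ}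

/-- The complex number whose real and imaginary parts are the coordinates of `y` in the basis of
the columns of `U`. -/
def planarCoord (U : Matrix (Fin 2) (Fin 2) ℝ) (y : EuclideanSpace ℝ (Fin 2)) : ℂ :=
  ⟨(Uᵀ *ᵥ y.ofLp) 0, (Uᵀ *ᵥ y.ofLp) 1⟩

/-- The `i`-th row of `U` as a complex number, conjugated so that multiplication by it represents
the inner product: the `i`-th coordinate of `y` is `Re (conjRow U i * planarCoord U y)`. -/
def conjRow (U : Matrix (Fin 2) (Fin 2) ℝ) (i : Fin 2) : ℂ :=
  ⟨U i 0, -U i 1⟩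

lemma measurable_planarCoord : Measurable (planarCoord U) := by
  refine Complex.measurableEquivRealProd.symm.measurable.comp (f :=
    fun y : EuclideanSpace ℝ (Fin 2) => ((Uᵀ *ᵥ y.ofLp) 0, (Uᵀ *ᵥ y.ofLp) 1)) ?_
  simp only [Matrix.mulVec, dotProduct]
  fun_prop

lemma measurable_sqDirection_planarCoord_sub (m : EuclideanSpace ℝ (Fin 2)) :
    Measurable fun x => sqDirection (planarCoord U (x - m)) :=
  measurable_sqDirection.comp (measurable_planarCoord.comp (measurable_sub_const m))

lemma re_conjRow_mul_planarCoord (hU : U ∈ Matrix.orthogonalGroup (Fin 2) ℝ)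
    (y : EuclideanSpace ℝ (Fin 2)) (i : Fin 2) : (conjRow U i * planarCoord U y).re = y i := by
  have hy : (U *ᵥ (Uᵀ *ᵥ y.ofLp)) i = y i := by
    rw [Matrix.mulVec_mulVec, (Matrix.mem_orthogonalGroup_iff _ _).1 hU, Matrix.one_mulVec]
  rw [← hy, Matrix.mulVec, dotProduct, Fin.sum_univ_two, Complex.mul_re]
  simp only [conjRow, planarCoord, neg_mul, sub_neg_eq_add]

lemma norm_planarCoord (hU : U ∈ Matrix.orthogonalGroup (Fin 2) ℝ)
    (y : EuclideanSpace ℝ (Fin 2)) : ‖planarCoord U y‖ = ‖y‖ := by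
  have hdot : (Uᵀ *ᵥ y.ofLp) ⬝ᵥ (Uᵀ *ᵥ y.ofLp) = y.ofLp ⬝ᵥ y.ofLp := by
    rw [Matrix.dotProduct_mulVec, Matrix.vecMul_transpose, Matrix.mulVec_mulVec,
      (Matrix.mem_orthogonalGroup_iff _ _).1 hU, Matrix.one_mulVec]
  rw [← sq_eq_sq₀ (norm_nonneg _) (norm_nonneg _), Complex.sq_norm, Complex.normSq_apply,
    EuclideanSpace.real_norm_sq_eq]
  simpa only [planarCoord, dotProduct, Fin.sum_univ_two, sq] using hdot

lemma signOuter_apply_eq_re_sqDirection (hU : U ∈ Matrix.orthogonalGroup (Fin 2) ℝ)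
    {y : EuclideanSpace ℝ (Fin 2)} (hy : y ≠ 0) (i j : Fin 2) :
    signOuter y i j = (conjRow U i * starRingEnd ℂ (conjRow U j)).re / 2 +
      (conjRow U i * conjRow U j / 2 * sqDirection (planarCoord U y)).re := by
  have hprod : y i * y j = ((conjRow U i * conjRow U j * sqDirection (planarCoord U y)).re +
      (conjRow U i * starRingEnd ℂ (conjRow U j)).re) / 2 * ‖y‖ ^ 2 := by
    rw [← re_conjRow_mul_planarCoord hU y i, ← re_conjRow_mul_planarCoord hU y j,
      re_mul_mul_re_mul, ← sqDirection_mul_sq_norm, norm_planarCoord hU, ← mul_assoc,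
      ← Complex.ofReal_pow, Complex.re_mul_ofReal]
    ring
  have hsplit : (conjRow U i * conjRow U j / 2 * sqDirection (planarCoord U y)).re =
      (conjRow U i * conjRow U j * sqDirection (planarCoord U y)).re / 2 := by
    rw [div_mul_eq_mul_div, Complex.div_ofNat_re]
  have hy' : ‖y‖ ≠ 0 := norm_ne_zero_iff.2 hy
  calc signOuter y i j = y i * y j / ‖y‖ ^ 2 := by
        rw [signOuter, Matrix.vecMulVec_apply, spatialSign, PiLp.smul_apply, PiLp.smul_apply,
          smul_eq_mul, smul_eq_mul]
        field_simp
    _ = _ := by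
        rw [hprod, mul_div_cancel_right₀ _ (pow_ne_zero 2 hy'), hsplit]
        ring

lemma pos_of_posDef_orthogonal_mul_diagonal {p : ℕ} {U : Matrix (Fin p) (Fin p) ℝ} {lam : Fin p → ℝ}
    (hU : U ∈ Matrix.orthogonalGroup (Fin p) ℝ) (h : (U * Matrix.diagonal lam * Uᵀ).PosDef)
    (i : Fin p) : 0 < lam i := by
  have hUunit : IsUnit U := .of_mul_eq_one Uᵀ ((Matrix.mem_orthogonalGroup_iff _ _).1 hU)
  exact Matrix.posDef_diagonal_iff.1 ((Matrix.IsUnit.posDef_star_right_conjugate_iff hUunit).1 h) i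

lemma orthogonal_mul_diagonal_eq_mul_transpose {p : ℕ} (U : Matrix (Fin p) (Fin p) ℝ)
    {lam : Fin p → ℝ} (hlam : ∀ i, 0 ≤ lam i) :
    U * Matrix.diagonal lam * Uᵀ =
      (U * Matrix.diagonal fun i => √(lam i)) * (U * Matrix.diagonal fun i => √(lam i))ᵀ := by
  have hsqrt : Matrix.diagonal (fun i => √(lam i)) * Matrix.diagonal (fun i => √(lam i)) =
      Matrix.diagonal lam := by
    simp only [Matrix.diagonal_mul_diagonal, Real.mul_self_sqrt (hlam _)]
  rw [Matrix.transpose_mul, Matrix.diagonal_transpose, ← hsqrt]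
  simp only [Matrix.mul_assoc]

lemma planarCoord_toEuclideanLin (hU : U ∈ Matrix.orthogonalGroup (Fin 2) ℝ) (d : Fin 2 → ℝ)
    (z : ℂ) :
    planarCoord U (Matrix.toEuclideanLin (U * Matrix.diagonal d)
      (Complex.orthonormalBasisOneI.repr z)) = ⟨d 0 * z.re, d 1 * z.im⟩ := by
  rw [planarCoord, Matrix.ofLp_toLpLin, Matrix.toLin'_apply, Matrix.mulVec_mulVec,
    ← Matrix.mul_assoc, (Matrix.mem_orthogonalGroup_iff' _ _).1 hU, Matrix.one_mul,
    Complex.orthonormalBasisOneI_repr_apply, Matrix.mulVec_diagonal, Matrix.mulVec_diagonal]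
  rfl

lemma IsElliptical.integral_sqDirection_pow [IsProbabilityMeasure F]
    (h : IsElliptical F m (U * Matrix.diagonal lam * Uᵀ))
    (hU : U ∈ Matrix.orthogonalGroup (Fin 2) ℝ) (k : ℕ) :
    ∫ x, sqDirection (planarCoord U (x - m)) ^ k ∂F =
      (((√(lam 0) - √(lam 1)) / (√(lam 0) + √(lam 1)) : ℝ) : ℂ) ^ k := by
  have hpos := pos_of_posDef_orthogonal_mul_diagonal hU h.1
  rw [orthogonal_mul_diagonal_eq_mul_transpose U fun i => (hpos i).le] at h
  obtain ⟨g, hg⟩ := h.exists_integral_eq ℂ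
  have hradial : ∀ k : ℕ, ∫ x, sqDirection (planarCoord U (x - m)) ^ k ∂F =
      ((2 * Real.pi) * ∫ r in Set.Ioi (0 : ℝ), r * g (r ^ 2)) •
        (((√(lam 0) - √(lam 1)) / (√(lam 0) + √(lam 1)) : ℝ) : ℂ) ^ k := by
    intro k
    rw [hg fun y => sqDirection (planarCoord U y) ^ k,
      ← Complex.orthonormalBasisOneI.repr.measurePreserving.integral_comp
        Complex.orthonormalBasisOneI.repr.toHomeomorph.measurableEmbedding]
    simp_rw [LinearIsometryEquiv.norm_map, planarCoord_toEuclideanLin hU]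
    rw [integral_radial_smul (fun r => g (r ^ 2))
      (f := fun z => sqDirection ⟨√(lam 0) * z.re, √(lam 1) * z.im⟩ ^ k),
      circleAverage_sqDirection_pow (Real.sqrt_pos.2 (hpos 0)) (Real.sqrt_pos.2 (hpos 1))]
    intro r hr z
    rw [← sqDirection_ofReal_mul hr.ne' ⟨√(lam 0) * z.re, √(lam 1) * z.im⟩]
    congr 2
    apply Complex.ext <;>
      simp only [Complex.re_ofReal_mul, Complex.im_ofReal_mul, mul_left_comm]
  have hconst : ((2 * Real.pi) * ∫ r in Set.Ioi (0 : ℝ), r * g (r ^ 2)) • (1 : ℂ) = 1 := by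
    simpa only [pow_zero, integral_const, probReal_univ, one_smul] using (hradial 0).symm
  rw [hradial k, ← one_mul (_ ^ k), ← smul_mul_assoc, hconst, one_mul]

lemma covFactor_eq {a b : ℝ} (ha : 0 < a) (hb : 0 < b) :
    covFactor a b = (1 - ((√a - √b) / (√a + √b)) ^ 2) / 8 := by
  rw [covFactor]
  split_ifs with hab
  · rw [hab, sub_self, zero_div, zero_pow two_ne_zero, sub_zero]
  · have hsum : √a + √b ≠ 0 := (add_pos (Real.sqrt_pos.2 ha) (Real.sqrt_pos.2 hb)).ne'
    have hsub : √a - √b ≠ 0 := sub_ne_zero.2 fun h => hab ((Real.sqrt_inj ha.le hb.le).1 h)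
    have hfactor : a - b = (√a - √b) * (√a + √b) := by
      linear_combination -Real.sq_sqrt ha.le + Real.sq_sqrt hb.le
    rw [hfactor, Real.sqrt_mul ha.le]
    nth_rw 1 3 [← Real.sq_sqrt ha.le]
    nth_rw 1 3 [← Real.sq_sqrt hb.le]
    field_simp
    ring

lemma kronecker_mul_W₀_mul_transpose_apply (q r : Fin 2 × Fin 2) :
    ((U ⊗ₖ U) * W₀.submatrix (vecIndex rfl) (vecIndex rfl) * (U ⊗ₖ U)ᵀ) q r =
      (conjRow U q.2 * conjRow U q.1 *
        starRingEnd ℂ (conjRow U r.2 * conjRow U r.1)).re := by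
  have h00 : vecIndex (p := 2) rfl (0, 0) = 0 := rfl
  have h01 : vecIndex (p := 2) rfl (0, 1) = 1 := rfl
  have h10 : vecIndex (p := 2) rfl (1, 0) = 2 := rfl
  have h11 : vecIndex (p := 2) rfl (1, 1) = 3 := rfl
  simp only [Matrix.mul_apply, Fintype.sum_prod_type, Fin.sum_univ_two, Matrix.transpose_apply,
    Matrix.kroneckerMap_apply, Matrix.submatrix_apply, h00, h01, h10, h11, conjRow,
    Complex.mul_re, Complex.mul_im, Complex.conj_re, Complex.conj_im, map_mul]
  simp only [W₀, Matrix.of_apply, Matrix.cons_val, Matrix.cons_val', Matrix.cons_val_zero,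
    Matrix.cons_val_one, Matrix.cons_val_fin_one]
  ring

lemma norm_sqDirection_planarCoord (hU : U ∈ Matrix.orthogonalGroup (Fin 2) ℝ)
    {y : EuclideanSpace ℝ (Fin 2)} (hy : y ≠ 0) : ‖sqDirection (planarCoord U y)‖ = 1 :=
  norm_sqDirection <| norm_ne_zero_iff.1 <| (norm_planarCoord hU y).trans_ne (norm_ne_zero_iff.2 hy)

lemma IsElliptical.covariance_re_mul_sqDirection [IsProbabilityMeasure F]
    (h : IsElliptical F m (U * Matrix.diagonal lam * Uᵀ))
    (hU : U ∈ Matrix.orthogonalGroup (Fin 2) ℝ) (u v : ℂ) :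
    cov[fun x => (u * sqDirection (planarCoord U (x - m))).re,
        fun x => (v * sqDirection (planarCoord U (x - m))).re; F] =
      4 * covFactor (lam 0) (lam 1) * (u * starRingEnd ℂ v).re := by
  have hpos := pos_of_posDef_orthogonal_mul_diagonal hU h.1
  have hmean := h.integral_sqDirection_pow hU 1
  simp only [pow_one] at hmean
  rw [covariance_re_mul (measurable_sqDirection_planarCoord_sub m).aestronglyMeasurable
    ((h.ae_ne m).mono fun x hx => norm_sqDirection_planarCoord hU (sub_ne_zero.2 hx))
    (by rw [hmean, h.integral_sqDirection_pow hU 2]), hmean, covFactor_eq (hpos 0) (hpos 1),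
    Complex.norm_real, Real.norm_eq_abs, sq_abs]
  ring

theorem IsElliptical.signCov_eq [IsProbabilityMeasure F]
    (h : IsElliptical F m (U * Matrix.diagonal lam * Uᵀ))
    (hU : U ∈ Matrix.orthogonalGroup (Fin 2) ℝ) :
    signCov F m = covFactor (lam 0) (lam 1) •
      ((U ⊗ₖ U) * W₀.submatrix (vecIndex rfl) (vecIndex rfl) * (U ⊗ₖ U)ᵀ) := by
  have hF := h.ae_ne m
  set ζ : EuclideanSpace ℝ (Fin 2) → ℂ := fun x => sqDirection (planarCoord U (x - m))
  have hint : ∀ w : ℂ, Integrable (fun x => (w * ζ x).re) F := fun w =>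
    ((Integrable.of_bound (measurable_sqDirection_planarCoord_sub m).aestronglyMeasurable 1
      (hF.mono fun x hx => (norm_sqDirection_planarCoord hU (sub_ne_zero.2 hx)).le)).const_mul w).re
  have hentry : ∀ q : Fin 2 × Fin 2, (fun x => vecE (signOuter (x - m)) q) =ᵐ[F] fun x =>
      (conjRow U q.2 * starRingEnd ℂ (conjRow U q.1)).re / 2 +
        (conjRow U q.2 * conjRow U q.1 / 2 * ζ x).re := fun q =>
    hF.mono fun x hx => signOuter_apply_eq_re_sqDirection hU (sub_ne_zero.2 hx) q.2 q.1
  have hfour : (2 : ℂ) * 2 = 4 := by norm_num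
  ext q r
  calc signCov F m q r
      = cov[fun x => vecE (signOuter (x - m)) q, fun x => vecE (signOuter (x - m)) r; F] := rfl
    _ = 4 * covFactor (lam 0) (lam 1) * (conjRow U q.2 * conjRow U q.1 / 2 *
          starRingEnd ℂ (conjRow U r.2 * conjRow U r.1 / 2)).re := by
        rw [covariance_congr_ae (hentry q) (hentry r), covariance_const_add_left (hint _),
          covariance_const_add_right (hint _), h.covariance_re_mul_sqDirection hU]
    _ = covFactor (lam 0) (lam 1) * (conjRow U q.2 * conjRow U q.1 *
          starRingEnd ℂ (conjRow U r.2 * conjRow U r.1)).re := by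
        rw [map_div₀, map_ofNat, div_mul_div_comm, hfour, Complex.div_ofNat_re]
        ring
    _ = _ := by rw [Matrix.smul_apply, kronecker_mul_W₀_mul_transpose_apply, smul_eq_mul]

end Planar

end SSCM

end

theorem proposition2_general {Ω : Type*} [MeasurableSpace Ω] (P : Measure Ω)
    [IsProbabilityMeasure P] {p : ℕ} (F : Measure (EuclideanSpace ℝ (Fin p)))
    [IsProbabilityMeasure F] (c : EuclideanSpace ℝ (Fin p)) (X : ℕ → Ω → EuclideanSpace ℝ (Fin p))
    (hX : ∀ i, HasLaw (X i) F P) (hindep : iIndepFun X P) (hc : ∀ᵐ x ∂F, x ≠ c)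
    (T : ℕ → Ω → EuclideanSpace ℝ (Fin p)) (hTmeas : ∀ n, AEMeasurable (T n) P)
    (hT : ∀ᵐ ω ∂P, Tendsto (fun n => T n ω) atTop (𝓝 c)) :
    (∀ᵐ ω ∂P, Tendsto (fun n : ℕ => SSCM.empiricalSSCM (fun i : Fin n => X i ω) (T n ω)) atTop
        (𝓝 (SSCM.sscmAt F c))) ∧
    ((∃ (ν : Measure ℝ) (_ : IsProbabilityMeasure ν),
        TendstoInDistribution (fun (n : ℕ) ω => √(n : ℝ) * ‖T n ω - c‖) atTop id (fun _ => P) ν) →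
      ∫⁻ x, ‖x - c‖ₑ⁻¹ ∂F < ∞ →
      F.map (fun x => x - c) = F.map (fun x => -(x - c)) →
      ∃ W : Matrix (Fin p × Fin p) (Fin p × Fin p) ℝ,
        W.PosSemidef ∧
        TendstoInDistribution
          (fun (n : ℕ) ω => √(n : ℝ) •
            SSCM.vecE (SSCM.empiricalSSCM (fun i : Fin n => X i ω) (T n ω) - SSCM.sscmAt F c))
          atTop id (fun _ => P) (multivariateGaussian 0 W) ∧
        ∀ (hp2 : p = 2) (m : EuclideanSpace ℝ (Fin p)) (U : Matrix (Fin p) (Fin p) ℝ)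
          (lam : Fin p → ℝ),
          SSCM.IsElliptical F m (U * Matrix.diagonal lam * Uᵀ) →
          U ∈ Matrix.orthogonalGroup (Fin p) ℝ →
          W = SSCM.covFactor (lam (Fin.cast hp2.symm 0)) (lam (Fin.cast hp2.symm 1)) •
            ((U ⊗ₖ U) * SSCM.W₀.submatrix (SSCM.vecIndex hp2) (SSCM.vecIndex hp2) *
              (U ⊗ₖ U)ᵀ)) := by
  refine ⟨SSCM.tendsto_empiricalSSCM_ae hX hindep hc hT, ?_⟩
  rintro ⟨ν, hν, hTν⟩ hmoment hsymm
  refine ⟨SSCM.signCov F c, SSCM.posSemidef_signCov,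
    SSCM.tendstoInDistribution_sqrt_smul_empiricalSSCM hX hindep hc
      (SSCM.integrable_inv_norm_sub hmoment) hsymm hTmeas hT hTν, ?_⟩
  rintro rfl m U lam hell hU
  obtain rfl : c = m := SSCM.eq_of_map_add_sub_eq_self (SSCM.map_add_sub_eq_self hsymm)
    hell.map_add_sub_eq_self
  exact hell.signCov_eq hU

theorem proposition2 {Ω : Type*} [MeasurableSpace Ω] (P : Measure Ω) [IsProbabilityMeasure P]
    {p : ℕ} (hp : 2 ≤ p)
    (F : Measure (EuclideanSpace ℝ (Fin p))) [IsProbabilityMeasure F]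
    (X : ℕ → Ω → EuclideanSpace ℝ (Fin p))
    (hX : ∀ i, HasLaw (X i) F P) (hindep : iIndepFun X P)
    (hF : ∫⁻ x, ‖x - SSCM.spatialMedian F‖ₑ⁻¹ ∂F < ∞)
    (T : ℕ → Ω → EuclideanSpace ℝ (Fin p))
    (hTmeas : ∀ n, AEMeasurable (T n) P)
    (hT : ∀ᵐ ω ∂P, Tendsto (fun n => T n ω) atTop (𝓝 (SSCM.spatialMedian F))) :
    (∀ᵐ ω ∂P, Tendsto (fun n : ℕ => SSCM.empiricalSSCM (fun i : Fin n => X i ω) (T n ω)) atTop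
        (𝓝 (SSCM.sscm F))) ∧
    ((∃ (ν : Measure ℝ) (_ : IsProbabilityMeasure ν),
        TendstoInDistribution (fun (n : ℕ) ω => √(n : ℝ) * ‖T n ω - SSCM.spatialMedian F‖)
          atTop id (fun _ => P) ν) →
      ∫⁻ x, ‖x - SSCM.spatialMedian F‖ₑ ^ (-(3 / 2) : ℝ) ∂F < ∞ →
      F.map (fun x => x - SSCM.spatialMedian F) = F.map (fun x => -(x - SSCM.spatialMedian F)) →
      ∃ W : Matrix (Fin p × Fin p) (Fin p × Fin p) ℝ,
        W.PosSemidef ∧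
        TendstoInDistribution
          (fun (n : ℕ) ω => √(n : ℝ) •
            SSCM.vecE (SSCM.empiricalSSCM (fun i : Fin n => X i ω) (T n ω) - SSCM.sscm F))
          atTop id (fun _ => P) (multivariateGaussian 0 W) ∧
        ∀ (hp2 : p = 2) (m : EuclideanSpace ℝ (Fin p)) (V U : Matrix (Fin p) (Fin p) ℝ)
          (lam : Fin p → ℝ),
          SSCM.IsElliptical F m V →
          U ∈ Matrix.orthogonalGroup (Fin p) ℝ →
          V = U * Matrix.diagonal lam * Uᵀ →
          lam ⟨1, by omega⟩ ≤ lam ⟨0, by omega⟩ →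
          W = SSCM.covFactor (lam ⟨0, by omega⟩) (lam ⟨1, by omega⟩) •
            ((U ⊗ₖ U) * SSCM.W₀.submatrix (SSCM.vecIndex hp2) (SSCM.vecIndex hp2) *
              (U ⊗ₖ U)ᵀ)) := by
  have h := proposition2_general P F (SSCM.spatialMedian F) X hX hindep
    (SSCM.ae_ne_of_lintegral_enorm_inv_lt_top hF) T hTmeas hT
  exact ⟨h.1, fun hν _ hsymm => (h.2 hν hF hsymm).imp fun W hW => ⟨hW.1, hW.2.1,
    fun hp2 m V U lam hell hU hV _ => hW.2.2 hp2 m U lam (hV ▸ hell) hU⟩⟩
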